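/- **Proposition 3.1.** Let $m,n\ge 1$, $d=m+n$, and let $w_1,\dots,w_{d}>0$ satisfy $\sum_{i=1}^m w_i=\sum_{j=1}^n w_{m+j}$. For $t\in\mathbb R$ and $\theta\in \mathrm M_{m\times n}(\mathbb R)$ put $$a_t=\operatorname{diag}(e^{w_1t},\dots,e^{w_mt},e^{-w_{m+1}t},\dots,e^{-w_{m+n}t}),\qquad u(\theta)=\begin{pmatrix} I_m&\theta\\0&I_n\end{pmatrix}.$$ Let $\tilde G=\mathrm{SL}_d(\mathbb R)\ltimes\mathbb R^d$, with elements $[g,b]$ multiplied by $[g,b][g',b']=[gg',b+gb']$, let $\tilde\Gamma=\mathrm{SL}_d(\mathbb Z)\ltimes\mathbb Z^d$, and let $\|\cdot\|$ be the sup norm on $\mathbb R^d$. A vector $\xi\in\mathbb R^d$ is called Liouville if for every $E>0$ there are infinitely many $(p,q)\in\mathbb Z^d\times\{1,2,3,\dots\}$ with $\|\xi-p/q\|<q^{-E}$. Let $y=[g,gv]\tilde\Gamma\in\tilde G/\tilde\Gamma$, where $g\in \mathrm{SL}_d(\mathbb R)$ and $v\in\mathbb R^d$ is not Liouville, and let $L>0$.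 Then there are constants $\beta_0,\beta_1,\beta_2>0$, depending only on $m$, $n$, the weights $w_i$, $y$ and $L$, such that for all $t\ge 0$ and all $0<A<1<B$, the set $S$ of all $\theta\in \mathrm M_{m\times n}([-L,L])$ for which the lattice $$\begin{pmatrix} a_tu(\theta)&0\\0&1\end{pmatrix}\begin{pmatrix} g&gv\\0&1\end{pmatrix}\mathbb Z^{d+1}$$ contains a nonzero vector $(x,s)\in\mathbb R^d\times\mathbb R$ with $\|x\|\le A$ and $|s|\le B$ has Lebesgue measure $$|S|\le \beta_0\,A^{\beta_1}B^{\beta_2}.$$ -/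

import Mathlib

open scoped Matrix MatrixGroups

noncomputable section

/-- `ξ ∈ ℝ^ι` is a Liouville vector: for every `E > 0` there are infinitely many
`(p, q) ∈ ℤ^ι × {1, 2, …}` with `‖ξ - p / q‖ < 1 / q ^ E` (sup norm). -/
def IsLiouvilleVector {ι : Type*} [Fintype ι] (ξ : ι → ℝ) : Prop :=
  ∀ E : ℝ, 0 < E →
    {pq : (ι → ℤ) × ℕ |
      1 ≤ pq.2 ∧ ‖ξ - fun i => (pq.1 i : ℝ) / (pq.2 : ℝ)‖ < 1 / (pq.2 : ℝ) ^ E}.Infinite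

section AffineGroup

variable (ι : Type*) [Fintype ι] [DecidableEq ι]

/-- The linear action of `SL_ι(ℝ)` on the additive group `ℝ^ι`. -/
def linAction : Matrix.SpecialLinearGroup ι ℝ →* MulAut (Multiplicative (ι → ℝ)) where
  toFun g := AddEquiv.toMultiplicative (Matrix.SpecialLinearGroup.toLin' g).toAddEquiv
  map_one' := by ext x; simp
  map_mul' g h := by ext x; simp

/-- The affine group `SL_ι(ℝ) ⋉ ℝ^ι`, with `[g, b] * [g', b'] = [g * g', b + g b']`. -/
abbrev AffineSL : Type _ :=
  Multiplicative (ι → ℝ) ⋊[linAction ι] Matrix.SpecialLinearGroup ι ℝ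

variable {ι}

/-- The element `[g, b]` of `SL_ι(ℝ) ⋉ ℝ^ι`. -/
def affineElt (g : Matrix.SpecialLinearGroup ι ℝ) (b : ι → ℝ) : AffineSL ι :=
  ⟨Multiplicative.ofAdd b, g⟩

theorem affineElt_mul (g g' : Matrix.SpecialLinearGroup ι ℝ) (b b' : ι → ℝ) :
    affineElt g b * affineElt g' b' =
      affineElt (g * g') (b + (g : Matrix ι ι ℝ) *ᵥ b') := by
  rfl

variable (ι)

/-- The subgroup `SL_ι(ℤ) ⋉ ℤ^ι` of `SL_ι(ℝ) ⋉ ℝ^ι`. -/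
def affineSLInt : Subgroup (AffineSL ι) where
  carrier := {x | ∃ (γ : Matrix.SpecialLinearGroup ι ℤ) (k : ι → ℤ),
    x = affineElt (Matrix.SpecialLinearGroup.map (Int.castRingHom ℝ) γ) (fun i => (k i : ℝ))}
  one_mem' := ⟨1, 0, by simp; rfl⟩
  mul_mem' := by
    rintro _ _ ⟨γ, k, rfl⟩ ⟨γ', k', rfl⟩
    refine ⟨γ * γ', k + (γ : Matrix ι ι ℤ) *ᵥ k', ?_⟩
    rw [affineElt_mul, map_mul]
    congr 1
    ext i
    simp [Matrix.mulVec, dotProduct]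
  inv_mem' := by
    rintro _ ⟨γ, k, rfl⟩
    refine ⟨γ⁻¹, -(((γ⁻¹ : Matrix.SpecialLinearGroup ι ℤ) : Matrix ι ι ℤ) *ᵥ k), ?_⟩
    rw [inv_eq_iff_mul_eq_one, affineElt_mul, ← map_mul, mul_inv_cancel, map_one]
    have h : (γ : Matrix ι ι ℤ) *ᵥ
        (-(((γ⁻¹ : Matrix.SpecialLinearGroup ι ℤ) : Matrix ι ι ℤ) *ᵥ k)) = -k := by
      rw [Matrix.mulVec_neg, Matrix.mulVec_mulVec, ← Matrix.SpecialLinearGroup.coe_mul,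
        mul_inv_cancel, Matrix.SpecialLinearGroup.coe_one, Matrix.one_mulVec]
    change affineElt _ _ = affineElt 1 0
    congr 1
    ext i
    have h' := congrArg (fun z : ℤ => (z : ℝ)) (congrFun h i)
    simp only [Matrix.mulVec, dotProduct, Pi.neg_apply, Int.cast_sum, Int.cast_mul,
      Int.cast_neg] at h'
    simp [Matrix.mulVec, dotProduct] at h' ⊢
    linarith

/-- The space of affine unimodular lattices `(SL_ι(ℝ) ⋉ ℝ^ι) / (SL_ι(ℤ) ⋉ ℤ^ι)`. -/
abbrev AffineLatticeSpace : Type _ := AffineSL ι ⧸ affineSLInt ι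

variable {ι}

/-- The matrix `(h, b; 0, 1)` acting on `ℝ^ι × ℝ`. -/
def affineMatrix (h : Matrix ι ι ℝ) (b : ι → ℝ) : Matrix (ι ⊕ Unit) (ι ⊕ Unit) ℝ :=
  Matrix.fromBlocks h (Matrix.replicateCol Unit b) 0 1

/-- The set `M ℤ^κ` of images of integer vectors under a matrix `M`. -/
def integerImage {κ : Type*} [Fintype κ] (M : Matrix κ κ ℝ) : Set (κ → ℝ) :=
  Set.range fun k : κ → ℤ => M *ᵥ fun i => (k i : ℝ)

/-- The cylinder `{(x, y) ∈ ℝ^ι × ℝ : ‖x‖ ≤ A, |y| ≤ B}` (sup norm on `ℝ^ι`). -/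
def thinCylinder (A B : ℝ) : Set (ι ⊕ Unit → ℝ) :=
  {z | ‖fun i => z (Sum.inl i)‖ ≤ A ∧ |z (Sum.inr ())| ≤ B}

end AffineGroup

section Flow

variable {m n : ℕ}

/-- `a_t = diag(e^{w_1 t}, …, e^{w_m t}, e^{-w_{m+1} t}, …, e^{-w_{m+n} t})`. -/
def diagFlow (w : Fin m ⊕ Fin n → ℝ) (t : ℝ) : Matrix (Fin m ⊕ Fin n) (Fin m ⊕ Fin n) ℝ :=
  Matrix.diagonal (Sum.elim (fun i => Real.exp (w (Sum.inl i) * t))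
    (fun j => Real.exp (-(w (Sum.inr j)) * t)))

/-- `u(θ) = (I_m, θ; 0, I_n)`. -/
def unipotent (θ : Fin m → Fin n → ℝ) : Matrix (Fin m ⊕ Fin n) (Fin m ⊕ Fin n) ℝ :=
  Matrix.fromBlocks 1 (Matrix.of θ) 0 1

/-- The set of `θ ∈ M_{m×n}([-L, L])` such that
`diag(a_t u(θ), 1) (g, g v; 0, 1) ℤ^{d+1}` contains a nonzero vector `(x, y)` with
`‖x‖ ≤ A` and `|y| ≤ B`. -/
def cylinderSet (w : Fin m ⊕ Fin n → ℝ) (g : Matrix.SpecialLinearGroup (Fin m ⊕ Fin n) ℝ)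
    (v : Fin m ⊕ Fin n → ℝ) (t L A B : ℝ) : Set (Fin m → Fin n → ℝ) :=
  {θ | (∀ i j, θ i j ∈ Set.Icc (-L) L) ∧
    ∃ z ∈ integerImage (affineMatrix (diagFlow w t * unipotent θ) 0 *
        affineMatrix (g : Matrix (Fin m ⊕ Fin n) (Fin m ⊕ Fin n) ℝ)
          ((g : Matrix (Fin m ⊕ Fin n) (Fin m ⊕ Fin n) ℝ) *ᵥ v)),
      z ≠ 0 ∧ z ∈ thinCylinder A B}

end Flow

end

/-!
Write `Λ` for the lattice `(g, g v; 0, 1) ℤ^{d+1}`. A matrix `θ` lies in the set to be measured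
only if some nonzero `(x', x'', s) ∈ Λ` satisfies `|x'_i + (θ x'')_i| ≤ A e^{-w_i t}`,
`|x''_j| ≤ A e^{w_{m+j} t}` and `|s| ≤ B`. For one such vector these `θ` have measure
`≪ ∏ i, A e^{-w_i t} / ‖x''‖`, since each row of `θ` is confined to a slab of a cube. Unless
`‖(x', x'')‖ ≪ A`, they exist only if `‖x'‖ ≪ ‖x''‖`, so for a given integer part `z` of `x''` there
are `≪ B (1 + ‖x''‖) ^ m` vectors to consider, and the powers of `‖x''‖` cancel. Summing over the
`≪ ∏ j, e^{w_{m+j} t}` values of `z`, the exponentials cancel as well, by the hypothesis on the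
weights. That `v` is not Liouville keeps `‖(x', x'')‖` above a constant times a negative power of
`B`, which is what makes these estimates uniform.
-/

open MeasureTheory Filter Topology Set
open scoped ENNReal

section Liouville

variable {ι : Type*} [Fintype ι] {v : ι → ℝ}

theorem IsLiouvilleVector.of_eq_div {p : ι → ℤ} {q : ℕ} (hq : 1 ≤ q)
    (hv : v = fun i => (p i : ℝ) / q) : IsLiouvilleVector v := by
  intro E _
  refine infinite_of_injective_forall_mem
    (f := fun k : ℕ => (((k : ℤ) + 1) • p, (k + 1) * q)) (fun k l hkl => ?_) fun k => ?_
  · simpa [Nat.one_le_iff_ne_zero.1 hq] using congrArg Prod.snd hkl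
  · have hkq : 1 ≤ (k + 1) * q := Nat.mul_pos k.succ_pos hq
    have hk : (k : ℝ) + 1 ≠ 0 := by positivity
    refine ⟨hkq, ?_⟩
    have hzero : (v - fun i => (((((k : ℤ) + 1) • p) i : ℤ) : ℝ) / ((k + 1) * q : ℕ)) = 0 := by
      ext i
      simp [hv, mul_div_mul_left _ _ hk]
    have hkq' : (0 : ℝ) < ((k + 1) * q : ℕ) := by exact_mod_cast hkq
    simp only [hzero, norm_zero]
    exact one_div_pos.2 (Real.rpow_pos_of_pos hkq' E)

theorem exists_le_rpow_mul_norm_sub_of_not_isLiouvilleVector (hv : ¬ IsLiouvilleVector v) :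
    ∃ c > 0, ∃ E > (0 : ℝ), ∀ (p : ι → ℤ) (q : ℕ), 1 ≤ q →
      c ≤ (q : ℝ) ^ E * ‖v - fun i => (p i : ℝ) / q‖ := by
  have hv' := hv
  simp only [IsLiouvilleVector, not_forall, not_infinite] at hv'
  obtain ⟨E, hE, hfin⟩ := hv'
  have hpos : ∀ (p : ι → ℤ) (q : ℕ), 1 ≤ q →
      0 < (q : ℝ) ^ E * ‖v - fun i => (p i : ℝ) / q‖ := fun p q hq =>
    mul_pos (by positivity) <| norm_pos_iff.2 fun h =>
      hv (.of_eq_div hq (sub_eq_zero.1 h))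
  have hsmall : ∀ᶠ c in 𝓝[>] (0 : ℝ), ∀ pq ∈ {pq : (ι → ℤ) × ℕ |
      1 ≤ pq.2 ∧ ‖v - fun i => (pq.1 i : ℝ) / (pq.2 : ℝ)‖ < 1 / (pq.2 : ℝ) ^ E},
      c ≤ (pq.2 : ℝ) ^ E * ‖v - fun i => (pq.1 i : ℝ) / pq.2‖ :=
    (eventually_all_finite hfin).2 fun pq hpq =>
      eventually_nhdsWithin_of_eventually_nhds (eventually_le_nhds (hpos pq.1 pq.2 hpq.1))
  obtain ⟨c, ⟨hc, hc1⟩, hc0⟩ := ((hsmall.and (eventually_nhdsWithin_of_eventually_nhds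
    (eventually_le_nhds one_pos))).and self_mem_nhdsWithin).exists
  refine ⟨c, hc0, E, hE, fun p q hq => ?_⟩
  by_cases hpq : ‖v - fun i => (p i : ℝ) / q‖ < 1 / (q : ℝ) ^ E
  · exact hc (p, q) ⟨hq, hpq⟩
  · rw [not_lt, div_le_iff₀' (by positivity)] at hpq
    exact hc1.trans hpq

theorem exists_le_rpow_mul_norm_add_of_not_isLiouvilleVector (hv : ¬ IsLiouvilleVector v) :
    ∃ c > 0, ∃ E > (0 : ℝ), ∀ (p : ι → ℤ) (q : ℤ), q ≠ 0 →
      c ≤ |(q : ℝ)| ^ E * ‖(fun i => (p i : ℝ)) + (q : ℝ) • v‖ := by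
  obtain ⟨c, hc, E, hE, h⟩ := exists_le_rpow_mul_norm_sub_of_not_isLiouvilleVector hv
  have hnat : ∀ (p : ι → ℤ) (q : ℕ), 1 ≤ q →
      c ≤ (q : ℝ) ^ E * ‖(fun i => (p i : ℝ)) + (q : ℝ) • v‖ := by
    intro p q hq
    have hq1 : (1 : ℝ) ≤ q := by exact_mod_cast hq
    have hscale : (fun i => (p i : ℝ)) + (q : ℝ) • v =
        (q : ℝ) • (v - fun i => ((-p) i : ℝ) / q) := by
      ext i
      simp only [Pi.add_apply, Pi.smul_apply, Pi.sub_apply, Pi.neg_apply, smul_eq_mul,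
        Int.cast_neg]
      field_simp
      ring
    rw [hscale, norm_smul, Real.norm_natCast]
    refine (h (-p) q hq).trans ?_
    simp only [Pi.neg_apply, Int.cast_neg]
    gcongr
    exact le_mul_of_one_le_left (norm_nonneg _) hq1
  refine ⟨c, hc, E, hE, fun p q hq => ?_⟩
  obtain ⟨k, rfl | rfl⟩ := Int.eq_nat_or_neg q
  · simpa using hnat p k (by lia)
  · have hneg : (fun i => (p i : ℝ)) + ((-(k : ℤ) : ℤ) : ℝ) • v =
        -((fun i => ((-p) i : ℝ)) + (k : ℝ) • v) := by
      ext i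
      simp [add_comm]
    rw [hneg, norm_neg]
    simpa using hnat (-p) k (by lia)

end Liouville

section Counting

theorem measure_biUnion_le_of_encard_le {α β : Type*} [MeasurableSpace α] {μ : Measure α}
    {S : Set β} (hS : S.Countable) {f : β → Set α} {c d : ℝ≥0∞} (hc : (S.encard : ℝ≥0∞) ≤ c)
    (hd : ∀ b ∈ S, μ (f b) ≤ d) : μ (⋃ b ∈ S, f b) ≤ c * d :=
  calc μ (⋃ b ∈ S, f b) ≤ ∑' b : S, μ (f b) := measure_biUnion_le μ hS f
    _ ≤ ∑' _ : S, d := ENNReal.tsum_le_tsum fun b => hd b b.2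
    _ = S.encard * d := ENNReal.tsum_set_const S d
    _ ≤ c * d := by gcongr

variable {ι : Type*} [Fintype ι]

theorem countable_integerImage (h : Matrix ι ι ℝ) : (integerImage h).Countable :=
  countable_range _

theorem intCast_mem_integerImage_one [DecidableEq ι] (k : ι → ℤ) :
    (fun i => (k i : ℝ)) ∈ integerImage (1 : Matrix ι ι ℝ) :=
  ⟨k, Matrix.one_mulVec _⟩

theorem exists_abs_mulVec_sub_le (h : Matrix ι ι ℝ) :
    ∃ G ≥ 0, ∀ u k : ι → ℝ, (∀ i, |u i - k i| ≤ 1) →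
      ∀ i, |(h *ᵥ u) i - (h *ᵥ k) i| ≤ G := by
  let T := LinearMap.toContinuousLinearMap h.mulVecLin
  refine ⟨‖T‖, norm_nonneg T, fun u k huk i => ?_⟩
  calc |(h *ᵥ u) i - (h *ᵥ k) i| = ‖T (u - k) i‖ := by simp [T, Matrix.mulVec_sub]
    _ ≤ ‖T (u - k)‖ := norm_le_pi_norm _ i
    _ ≤ ‖T‖ * ‖u - k‖ := T.le_opNorm _
    _ ≤ ‖T‖ := mul_le_of_le_one_right (norm_nonneg T)
        ((pi_norm_le_iff_of_nonneg zero_le_one).2 huk)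

theorem encard_eq_volume_biUnion_unitCube (K : Set (ι → ℤ)) :
    (K.encard : ℝ≥0∞) =
      volume (⋃ k ∈ K, univ.pi fun i => Ico (k i : ℝ) (k i + 1)) := by
  have hdisj : K.PairwiseDisjoint fun k => univ.pi fun i => Ico (k i : ℝ) (k i + 1) := by
    refine fun k _ l _ hkl => disjoint_left.2 fun u hk hl => hkl <| funext fun i => ?_
    rw [← Int.floor_eq_iff.2 (hk i trivial), ← Int.floor_eq_iff.2 (hl i trivial)]
  rw [measure_biUnion K.to_countable hdisj fun k _ =>
    MeasurableSet.univ_pi fun i => measurableSet_Ico]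
  simp [Real.volume_pi_Ico]

/-- Packing: the images of the unit cubes at the lattice points have volume `|det h|`, are
disjoint and fit into a slightly larger box. -/
theorem exists_encard_integerImage_inter_box_le [DecidableEq ι] {h : Matrix ι ι ℝ}
    (hh : h.det ≠ 0) :
    ∃ C > 0, ∀ c M : ι → ℝ, (∀ i, 1 ≤ M i) →
      ({y ∈ integerImage h | ∀ i, |y i - c i| ≤ M i}.encard : ℝ≥0∞) ≤
        ENNReal.ofReal (C * ∏ i, M i) := by
  obtain ⟨G, hG, hdist⟩ := exists_abs_mulVec_sub_le h
  refine ⟨|h.det⁻¹| * (2 * (1 + G)) ^ Fintype.card ι, by positivity, fun c M hM => ?_⟩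
  let K : Set (ι → ℤ) := {k | ∀ i, |(h *ᵥ fun i => (k i : ℝ)) i - c i| ≤ M i}
  have himage : {y ∈ integerImage h | ∀ i, |y i - c i| ≤ M i} ⊆
      (fun k : ι → ℤ => h *ᵥ fun i => (k i : ℝ)) '' K := by
    rintro _ ⟨⟨k, rfl⟩, hk⟩
    exact ⟨k, hk, rfl⟩
  have hcubes : (⋃ k ∈ K, univ.pi fun i => Ico (k i : ℝ) (k i + 1)) ⊆
      Matrix.toLin' h ⁻¹' univ.pi fun i => Metric.closedBall (c i) (M i + G) := by
    refine iUnion₂_subset fun k hk u hu i _ => ?_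
    have hku := hdist u (fun i => k i) (fun i => abs_le.2 ⟨by linarith [(hu i trivial).1],
      by linarith [(hu i trivial).2]⟩) i
    rw [Matrix.toLin'_apply, Metric.mem_closedBall, Real.dist_eq]
    linarith [abs_sub_le ((h *ᵥ u) i) ((h *ᵥ fun i => (k i : ℝ)) i) (c i), hk i]
  have hside : ∀ i, 2 * (M i + G) ≤ 2 * (1 + G) * M i := fun i => by
    linarith [le_mul_of_one_le_right hG (hM i)]
  calc ({y ∈ integerImage h | ∀ i, |y i - c i| ≤ M i}.encard : ℝ≥0∞)
      ≤ K.encard := by exact_mod_cast (encard_le_encard himage).trans (encard_image_le _ _)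
    _ = volume (⋃ k ∈ K, univ.pi fun i => Ico (k i : ℝ) (k i + 1)) :=
        encard_eq_volume_biUnion_unitCube K
    _ ≤ volume (Matrix.toLin' h ⁻¹'
          univ.pi fun i => Metric.closedBall (c i) (M i + G)) := measure_mono hcubes
    _ = ENNReal.ofReal |h.det⁻¹| * ∏ i, ENNReal.ofReal (2 * (M i + G)) := by
        rw [Measure.addHaar_preimage_linearMap _ (by rwa [LinearMap.det_toLin']),
          LinearMap.det_toLin', volume_pi_pi]
        simp only [Real.volume_closedBall]
    _ ≤ ENNReal.ofReal |h.det⁻¹| * ∏ i, ENNReal.ofReal (2 * (1 + G) * M i) := by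
        gcongr _ * ∏ i, ENNReal.ofReal ?_ with i
        exact hside i
    _ = ENNReal.ofReal (|h.det⁻¹| * (2 * (1 + G)) ^ Fintype.card ι * ∏ i, M i) := by
        rw [← ENNReal.ofReal_prod_of_nonneg fun i _ => by have := hM i; positivity,
          ← ENNReal.ofReal_mul (abs_nonneg _), Finset.prod_mul_distrib, Finset.prod_const,
          Finset.card_univ, mul_assoc]

end Counting

section Slab

variable {ι κ : Type*} [Fintype κ] {L : ℝ}

/-- The part of the slab `|a + η · b| ≤ ε` of `ℝ^κ` that lies in the cube `[-L, L]^κ`, to which a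
single row `η` of `θ` is confined. -/
def cubeSlab (L a : ℝ) (b : κ → ℝ) (ε : ℝ) : Set (κ → ℝ) :=
  {η | (∀ j, η j ∈ Icc (-L) L) ∧ |a + η ⬝ᵥ b| ≤ ε}

/-- The matrices `θ` with entries in `[-L, L]` such that `|(x' + θ x'')_i| ≤ ε_i` for all `i`,
where `x = (x', x'')`. Here `x' + θ x''` is the upper block of `u(θ) x`, and each row of `θ` is
constrained separately. -/
def slabMatrices (L : ℝ) (ε : ι → ℝ) (x : ι ⊕ κ → ℝ) : Set (ι → κ → ℝ) :=
  univ.pi fun i => cubeSlab L (x (Sum.inl i)) (x ∘ Sum.inr) (ε i)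

/-- Replacing the coordinate `η j` by `η · b` is linear with determinant `b j` and maps the slab
into a box. -/
theorem volume_cubeSlab_le_of_apply_ne_zero (hL : 0 ≤ L) (a : ℝ) {b : κ → ℝ} {j : κ}
    (hj : b j ≠ 0) {ε : ℝ} (hε : 0 ≤ ε) :
    volume (cubeSlab L a b ε) ≤
      ENNReal.ofReal (2 * (2 * L) ^ (Fintype.card κ - 1) * ε / |b j|) := by
  classical
  let T := Matrix.toLin' ((1 : Matrix κ κ ℝ).updateRow j b)
  have hT : ∀ η, T η = Function.update η j (b ⬝ᵥ η) := fun η => by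
    rw [Matrix.toLin'_apply, Matrix.updateRow_mulVec, Matrix.one_mulVec]
  have hdet : LinearMap.det T = b j := by
    rw [LinearMap.det_toLin', ← Matrix.cramer_transpose_apply, Matrix.transpose_one,
      Matrix.cramer_one, Module.End.one_apply]
  let lo : κ → ℝ := Function.update (fun _ => -L) j (-ε - a)
  let hi : κ → ℝ := Function.update (fun _ => L) j (ε - a)
  have hsub : cubeSlab L a b ε ⊆ T ⁻¹' Icc lo hi := by
    rintro η ⟨hη, hab⟩
    rw [abs_le, dotProduct_comm] at hab
    simp only [lo, hi, mem_preimage, hT, mem_Icc, update_le_update_iff]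
    exact ⟨⟨by linarith, fun k _ => (hη k).1⟩, ⟨by linarith, fun k _ => (hη k).2⟩⟩
  have hside : ∀ k, hi k - lo k = Function.update (fun _ => 2 * L) j (2 * ε) k := by
    intro k
    rcases eq_or_ne k j with rfl | hk
    · simp only [hi, lo, Function.update_self]
      ring
    · simp only [hi, lo, Function.update_of_ne hk]
      ring
  have hnonneg : ∀ k, 0 ≤ hi k - lo k := by
    intro k
    rw [hside]
    rcases eq_or_ne k j with rfl | hk <;> simp [*]
  calc volume (cubeSlab L a b ε) ≤ volume (T ⁻¹' Icc lo hi) := measure_mono hsub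
    _ = ENNReal.ofReal (|(b j)⁻¹| * ∏ k, (hi k - lo k)) := by
        rw [Measure.addHaar_preimage_linearMap _ (by rwa [hdet]), hdet, Real.volume_Icc_pi,
          ← ENNReal.ofReal_prod_of_nonneg fun k _ => hnonneg k, ENNReal.ofReal_mul (abs_nonneg _)]
    _ = ENNReal.ofReal (2 * (2 * L) ^ (Fintype.card κ - 1) * ε / |b j|) := by
        simp only [hside]
        rw [Finset.prod_update_of_mem (Finset.mem_univ j), Finset.prod_const,
          Finset.card_sdiff_of_subset (Finset.subset_univ _), Finset.card_univ,
          Finset.card_singleton, abs_inv]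
        congr 1
        ring

theorem volume_cubeSlab_le (hL : 0 ≤ L) (a : ℝ) {b : κ → ℝ} {ε r : ℝ} (hε : 0 ≤ ε) (hr : 0 < r)
    (hb : r ≤ ‖b‖) :
    volume (cubeSlab L a b ε) ≤ ENNReal.ofReal (2 * (2 * L) ^ (Fintype.card κ - 1) * ε / r) := by
  obtain ⟨j, hj⟩ : ∃ j, r ≤ |b j| := by
    by_contra! hlt
    exact hb.not_gt ((pi_norm_lt_iff hr).2 hlt)
  refine (volume_cubeSlab_le_of_apply_ne_zero hL a (abs_pos.1 (hr.trans_le hj)) hε).trans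
    (ENNReal.ofReal_le_ofReal ?_)
  gcongr

theorem volume_slabMatrices_le [Fintype ι] (hL : 0 ≤ L) {ε : ι → ℝ} (hε : ∀ i, 0 ≤ ε i)
    {x : ι ⊕ κ → ℝ} {r : ℝ} (hr : 0 < r) (hx : r ≤ ‖x ∘ Sum.inr‖) :
    volume (slabMatrices L ε x) ≤ ENNReal.ofReal
      ((2 * (2 * L) ^ (Fintype.card κ - 1) / r) ^ Fintype.card ι * ∏ i, ε i) := by
  rw [slabMatrices, volume_pi_pi]
  calc ∏ i, volume (cubeSlab L (x (Sum.inl i)) (x ∘ Sum.inr) (ε i))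
      ≤ ∏ i, ENNReal.ofReal (2 * (2 * L) ^ (Fintype.card κ - 1) * ε i / r) :=
        Finset.prod_le_prod' fun i _ => volume_cubeSlab_le hL _ (hε i) hr hx
    _ = _ := by
        rw [← ENNReal.ofReal_prod_of_nonneg fun i _ => by have := hε i; positivity]
        simp only [mul_div_right_comm _ (ε _), Finset.prod_mul_distrib, Finset.prod_const,
          Finset.card_univ]

theorem volume_setOf_forall_mem_Icc [Fintype ι] (hL : 0 ≤ L) :
    volume {θ : ι → κ → ℝ | ∀ i j, θ i j ∈ Icc (-L) L} =
      ENNReal.ofReal (((2 * L) ^ Fintype.card κ) ^ Fintype.card ι) := by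
  have hcube : {θ : ι → κ → ℝ | ∀ i j, θ i j ∈ Icc (-L) L} =
      univ.pi fun _ => univ.pi fun _ => Icc (-L) L := by
    ext θ
    simp only [mem_ofPred_eq, mem_univ_pi]
  rw [hcube, volume_pi_pi]
  simp only [volume_pi_pi, Real.volume_Icc, Finset.prod_const, Finset.card_univ,
    sub_neg_eq_add, ← two_mul]
  rw [ENNReal.ofReal_pow (by positivity), ENNReal.ofReal_pow (by positivity)]

theorem abs_dotProduct_le_of_mem_Icc {η : κ → ℝ} (hη : ∀ j, η j ∈ Icc (-L) L) (b : κ → ℝ) :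
    |η ⬝ᵥ b| ≤ Fintype.card κ * L * ‖b‖ :=
  calc |η ⬝ᵥ b| ≤ ∑ j, |η j * b j| := Finset.abs_sum_le_sum_abs _ _
    _ ≤ ∑ _j : κ, L * ‖b‖ := by
        refine Finset.sum_le_sum fun j _ => ?_
        have hηj : |η j| ≤ L := abs_le.2 (hη j)
        rw [abs_mul]
        exact mul_le_mul hηj (norm_le_pi_norm b j) (abs_nonneg _) ((abs_nonneg _).trans hηj)
    _ = Fintype.card κ * L * ‖b‖ := by simp [mul_assoc]

theorem abs_inl_le_of_mem_slabMatrices {ε : ι → ℝ} {x : ι ⊕ κ → ℝ} {θ : ι → κ → ℝ}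
    (hθ : θ ∈ slabMatrices L ε x) (i : ι) :
    |x (Sum.inl i)| ≤ ε i + Fintype.card κ * L * ‖x ∘ Sum.inr‖ := by
  obtain ⟨hcube, hslab⟩ := hθ i trivial
  have hdot := abs_dotProduct_le_of_mem_Icc hcube (x ∘ Sum.inr)
  rw [abs_le] at *
  constructor <;> linarith

theorem le_mul_norm_inr_of_mem_slabMatrices [Fintype ι] (hL : 0 ≤ L) {ε : ι → ℝ} {a : ℝ}
    (ha : 0 < a) (hε : ∀ i, ε i ≤ a) {x : ι ⊕ κ → ℝ} (hx : 2 * a ≤ ‖x‖) {θ : ι → κ → ℝ}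
    (hθ : θ ∈ slabMatrices L ε x) : a ≤ (1 + Fintype.card κ * L) * ‖x ∘ Sum.inr‖ := by
  have hnL : 0 ≤ Fintype.card κ * L * ‖x ∘ Sum.inr‖ := by positivity
  have hnorm : ‖x‖ ≤ a + (1 + Fintype.card κ * L) * ‖x ∘ Sum.inr‖ := by
    refine (pi_norm_le_iff_of_nonneg (by positivity)).2 ?_
    rintro (i | j)
    · refine (abs_inl_le_of_mem_slabMatrices hθ i).trans ?_
      linarith [hε i, norm_nonneg (x ∘ Sum.inr)]
    · refine (norm_le_pi_norm (x ∘ Sum.inr) j).trans ?_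
      linarith
  linarith

end Slab

section LatticeUnion

variable {ι κ : Type*} [Fintype ι] [Fintype κ] {h : Matrix ((ι ⊕ κ) ⊕ Unit) ((ι ⊕ κ) ⊕ Unit) ℝ}

/-- The vectors `(x', x'', s)` of the lattice `h ℤ^{d+1}` with `|x'_i| ≤ T`, `|x''_j - z_j| ≤ 1`,
`|s| ≤ B` and `ρ ≤ ‖x''‖`. On such a cell the measures of the sets `slabMatrices L ε (x', x'')`
admit a common bound. -/
def latticeCell (h : Matrix ((ι ⊕ κ) ⊕ Unit) ((ι ⊕ κ) ⊕ Unit) ℝ) (z : κ → ℝ) (T B ρ : ℝ) :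
    Set ((ι ⊕ κ) ⊕ Unit → ℝ) :=
  {y ∈ integerImage h | (∀ i, |y (Sum.inl (Sum.inl i))| ≤ T) ∧
    (∀ j, |y (Sum.inl (Sum.inr j)) - z j| ≤ 1) ∧ |y (Sum.inr ())| ≤ B ∧
    ρ ≤ ‖y ∘ Sum.inl ∘ Sum.inr‖}

/-- The vectors `(x, s)`, `x = (x', x'')`, of the lattice `h ℤ^{d+1}` with `2 a ≤ ‖x‖`,
`|x''_j| ≤ H_j` and `|s| ≤ B`. For suitable `a` and `H` no other nonzero lattice vector can
become short under `diag(a_t u(θ), 1)`. -/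
def longLatticeVectors (h : Matrix ((ι ⊕ κ) ⊕ Unit) ((ι ⊕ κ) ⊕ Unit) ℝ) (a : ℝ) (H : κ → ℝ)
    (B : ℝ) : Set ((ι ⊕ κ) ⊕ Unit → ℝ) :=
  {y ∈ integerImage h | 2 * a ≤ ‖y ∘ Sum.inl‖ ∧ (∀ j, |y (Sum.inl (Sum.inr j))| ≤ H j) ∧
    |y (Sum.inr ())| ≤ B}

theorem exists_encard_latticeCell_le [DecidableEq ι] [DecidableEq κ] (hh : h.det ≠ 0) :
    ∃ C > 0, ∀ (z : κ → ℝ) (T B ρ : ℝ), 1 ≤ T → 1 ≤ B →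
      ((latticeCell h z T B ρ).encard : ℝ≥0∞) ≤
        ENNReal.ofReal (C * (T ^ Fintype.card ι * B)) := by
  obtain ⟨C, hC, hcount⟩ := exists_encard_integerImage_inter_box_le hh
  refine ⟨C, hC, fun z T B ρ hT hB => ?_⟩
  let c : (ι ⊕ κ) ⊕ Unit → ℝ := Sum.elim (Sum.elim 0 z) 0
  let M : (ι ⊕ κ) ⊕ Unit → ℝ := Sum.elim (Sum.elim (fun _ => T) fun _ => 1) fun _ => B
  have hM : ∀ i, 1 ≤ M i := by
    rintro ((_ | _) | _)
    exacts [hT, le_rfl, hB]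
  have hsub : latticeCell h z T B ρ ⊆ {y ∈ integerImage h | ∀ i, |y i - c i| ≤ M i} := by
    rintro y ⟨hy, hT, hz, hB, _⟩
    refine ⟨hy, ?_⟩
    rintro ((i | j) | _)
    exacts [by simpa [c, M] using hT i, hz j, by simpa [c, M] using hB]
  calc ((latticeCell h z T B ρ).encard : ℝ≥0∞)
      ≤ ({y ∈ integerImage h | ∀ i, |y i - c i| ≤ M i}.encard : ℝ≥0∞) := by
        exact_mod_cast encard_le_encard hsub
    _ ≤ ENNReal.ofReal (C * ∏ i, M i) := hcount c M hM
    _ = ENNReal.ofReal (C * (T ^ Fintype.card ι * B)) := by simp [M]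

theorem exists_volume_biUnion_latticeCell_le [DecidableEq ι] [DecidableEq κ] (hh : h.det ≠ 0)
    {L : ℝ} (hL : 0 < L) :
    ∃ C > 0, ∀ (z : κ → ℝ) (T B ρ : ℝ) (ε : ι → ℝ), 1 ≤ T → 1 ≤ B → 0 < ρ → (∀ i, 0 ≤ ε i) →
      volume (⋃ y ∈ latticeCell h z T B ρ, slabMatrices L ε (y ∘ Sum.inl)) ≤
        ENNReal.ofReal (C * (B * (T / ρ) ^ Fintype.card ι * ∏ i, ε i)) := by
  obtain ⟨C, hC, hcount⟩ := exists_encard_latticeCell_le hh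
  refine ⟨C * (2 * (2 * L) ^ (Fintype.card κ - 1)) ^ Fintype.card ι, by positivity,
    fun z T B ρ ε hT hB hρ hε => ?_⟩
  refine (measure_biUnion_le_of_encard_le
    ((countable_integerImage h).mono fun y hy => hy.1) (hcount z T B ρ hT hB)
    fun y hy => volume_slabMatrices_le hL.le hε hρ hy.2.2.2.2).trans ?_
  rw [← ENNReal.ofReal_mul (by positivity)]
  refine ENNReal.ofReal_le_ofReal (le_of_eq ?_)
  simp only [div_pow]
  ring

/-- The cell is the one centred at the integer part `z` of `x''`: as `1 + ‖z‖` is comparable to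
`‖x''‖` up to a factor `1 / a`, the ratio of the two bounds defining the cell does not depend
on `z`. -/
theorem exists_mem_latticeCell_of_mem_slabMatrices [DecidableEq κ] {L a B : ℝ} (hL : 0 ≤ L)
    (ha : 0 < a) (ha1 : a ≤ 1) {ε : ι → ℝ} (hε : ∀ i, ε i ≤ a) {H : κ → ℝ} (hH : ∀ j, 1 ≤ H j)
    {y : (ι ⊕ κ) ⊕ Unit → ℝ} (hy : y ∈ longLatticeVectors h a H B) {θ : ι → κ → ℝ}
    (hθ : θ ∈ slabMatrices L ε (y ∘ Sum.inl)) :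
    ∃ z ∈ {z ∈ integerImage (1 : Matrix κ κ ℝ) | ∀ j, |z j - 0| ≤ 2 * H j},
      y ∈ latticeCell h z (2 * (1 + Fintype.card κ * L) * (1 + ‖z‖)) B
        (a * (1 + ‖z‖) / (3 * (1 + Fintype.card κ * L))) := by
  obtain ⟨hyh, hlong, hyH, hyB⟩ := hy
  set x : κ → ℝ := y ∘ Sum.inl ∘ Sum.inr
  set lam : ℝ := 1 + Fintype.card κ * L with hlam
  have hlam1 : 1 ≤ lam := le_add_of_nonneg_right (by positivity)
  have hax : a ≤ lam * ‖x‖ := le_mul_norm_inr_of_mem_slabMatrices hL ha hε hlong hθ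
  let z : κ → ℝ := fun j => ⌊x j⌋
  have hxz : ∀ j, |x j - z j| ≤ 1 := fun j => by
    rw [Int.self_sub_floor, Int.abs_fract]
    exact (Int.fract_lt_one _).le
  have hxz' : ‖x - z‖ ≤ 1 := (pi_norm_le_iff_of_nonneg zero_le_one).2 hxz
  have hx_le : ‖x‖ ≤ 1 + ‖z‖ := by linarith [norm_le_norm_add_norm_sub' x z]
  have hle_x : 1 + ‖z‖ ≤ 2 + ‖x‖ := by linarith [norm_le_norm_add_norm_sub x z]
  refine ⟨z, ⟨intCast_mem_integerImage_one _, fun j => ?_⟩, hyh, fun i => ?_, hxz, hyB, ?_⟩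
  · have hxj : |x j| ≤ H j := hyH j
    calc |z j - 0| = |x j - (x j - z j)| := by rw [sub_zero, sub_sub_cancel]
      _ ≤ |x j| + |x j - z j| := abs_sub _ _
      _ ≤ 2 * H j := by linarith [hxz j, hH j]
  · calc |y (Sum.inl (Sum.inl i))| ≤ ε i + Fintype.card κ * L * ‖x‖ :=
          abs_inl_le_of_mem_slabMatrices hθ i
      _ ≤ lam * ‖x‖ + lam * ‖x‖ := by
          gcongr
          exacts [(hε i).trans hax, by simp [hlam]]
      _ = 2 * lam * ‖x‖ := by ring
      _ ≤ 2 * lam * (1 + ‖z‖) := by gcongr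
  · rw [div_le_iff₀ (by positivity)]
    calc a * (1 + ‖z‖) ≤ a * (2 + ‖x‖) := by gcongr
      _ = 2 * a + a * ‖x‖ := by ring
      _ ≤ 2 * (lam * ‖x‖) + lam * ‖x‖ := by
          gcongr
          exact ha1.trans hlam1
      _ = ‖x‖ * (3 * lam) := by ring

theorem exists_volume_biUnion_longLatticeVectors_le [DecidableEq ι] [DecidableEq κ]
    (hh : h.det ≠ 0) {L : ℝ} (hL : 0 < L) :
    ∃ C > 0, ∀ (a B : ℝ) (ε : ι → ℝ) (H : κ → ℝ), 0 < a → a ≤ 1 → 1 ≤ B → (∀ i, 0 ≤ ε i) →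
      (∀ i, ε i ≤ a) → (∀ j, 1 ≤ H j) →
      volume (⋃ y ∈ longLatticeVectors h a H B, slabMatrices L ε (y ∘ Sum.inl)) ≤
        ENNReal.ofReal (C * (B * (1 / a) ^ Fintype.card ι * ((∏ i, ε i) * ∏ j, H j))) := by
  obtain ⟨C, hC, hcell⟩ := exists_volume_biUnion_latticeCell_le hh hL
  obtain ⟨C', hC', hcount⟩ :=
    exists_encard_integerImage_inter_box_le (h := (1 : Matrix κ κ ℝ)) (by simp)
  set lam : ℝ := 1 + Fintype.card κ * L
  have hlam1 : 1 ≤ lam := le_add_of_nonneg_right (by positivity)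
  refine ⟨C' * 2 ^ Fintype.card κ * C * (6 * lam ^ 2) ^ Fintype.card ι, by positivity,
    fun a B ε H ha ha1 hB hε hεa hH => ?_⟩
  have hcover : (⋃ y ∈ longLatticeVectors h a H B, slabMatrices L ε (y ∘ Sum.inl)) ⊆
      ⋃ z ∈ {z ∈ integerImage (1 : Matrix κ κ ℝ) | ∀ j, |z j - 0| ≤ 2 * H j},
        ⋃ y ∈ latticeCell h z (2 * lam * (1 + ‖z‖)) B (a * (1 + ‖z‖) / (3 * lam)),
          slabMatrices L ε (y ∘ Sum.inl) := by
    refine iUnion₂_subset fun y hy θ hθ => ?_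
    obtain ⟨z, hz, hyz⟩ := exists_mem_latticeCell_of_mem_slabMatrices hL.le ha ha1 hεa hH hy hθ
    exact mem_biUnion hz (mem_biUnion hyz hθ)
  have hcell' : ∀ z : κ → ℝ,
      volume (⋃ y ∈ latticeCell h z (2 * lam * (1 + ‖z‖)) B (a * (1 + ‖z‖) / (3 * lam)),
        slabMatrices L ε (y ∘ Sum.inl)) ≤
      ENNReal.ofReal (C * (B * (6 * lam ^ 2 * (1 / a)) ^ Fintype.card ι * ∏ i, ε i)) := by
    intro z
    have hz1 : 1 ≤ 1 + ‖z‖ := le_add_of_nonneg_right (norm_nonneg z)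
    have hratio : 2 * lam * (1 + ‖z‖) / (a * (1 + ‖z‖) / (3 * lam)) = 6 * lam ^ 2 * (1 / a) := by
      field_simp
      norm_num
    rw [← hratio]
    exact hcell z _ B _ ε (by nlinarith) hB (by positivity) hε
  refine (measure_mono hcover).trans ((measure_biUnion_le_of_encard_le
    ((countable_integerImage _).mono fun z hz => hz.1)
    (hcount 0 (fun j => 2 * H j) fun j => by linarith [hH j]) fun z _ => hcell' z).trans ?_)
  have hH0 : 0 ≤ ∏ j, 2 * H j := Finset.prod_nonneg fun j _ => by linarith [hH j]
  rw [← ENNReal.ofReal_mul (by positivity)]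
  refine ENNReal.ofReal_le_ofReal (le_of_eq ?_)
  rw [Finset.prod_mul_distrib, Finset.prod_const, Finset.card_univ, mul_pow]
  ring

end LatticeUnion

section AffineLattice

variable {ι : Type*}

theorem map_intCast_fromBlocks (γ : Matrix ι ι ℤ) (k : ι → ℤ) :
    (Matrix.fromBlocks γ (Matrix.replicateCol Unit k) 0 1).map (Int.cast : ℤ → ℝ) =
      affineMatrix (γ.map Int.cast) fun i => k i := by
  rw [affineMatrix, Matrix.fromBlocks_map, Matrix.map_zero _ Int.cast_zero,
    Matrix.map_one _ Int.cast_zero Int.cast_one]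
  rfl

variable [Fintype ι]

theorem integerImage_mul (M N : Matrix ι ι ℝ) :
    integerImage (M * N) = (M *ᵥ ·) '' integerImage N := by
  simp only [integerImage, ← range_comp, Function.comp_def, Matrix.mulVec_mulVec]

theorem integerImage_mul_map_intCast_subset (M : Matrix ι ι ℝ) (N : Matrix ι ι ℤ) :
    integerImage (M * N.map Int.cast) ⊆ integerImage M := by
  rintro _ ⟨k, rfl⟩
  refine ⟨N *ᵥ k, ?_⟩
  simp only [← Matrix.mulVec_mulVec]
  congr 1
  ext i
  simp [Matrix.mulVec, dotProduct]

theorem affineMatrix_mul (h h' : Matrix ι ι ℝ) (b b' : ι → ℝ) :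
    affineMatrix h b * affineMatrix h' b' = affineMatrix (h * h') (b + h *ᵥ b') := by
  simp only [affineMatrix, Matrix.fromBlocks_multiply]
  ext (i | i) (j | j) <;>
    simp [Matrix.mulVec, dotProduct, Matrix.mul_apply, add_comm]

theorem det_affineMatrix [DecidableEq ι] (h : Matrix ι ι ℝ) (b : ι → ℝ) :
    (affineMatrix h b).det = h.det := by
  rw [affineMatrix, Matrix.det_fromBlocks_zero₂₁, Matrix.det_one, mul_one]

theorem affineMatrix_mulVec (h : Matrix ι ι ℝ) (b : ι → ℝ) (y : ι ⊕ Unit → ℝ) :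
    affineMatrix h b *ᵥ y =
      Sum.elim (h *ᵥ (y ∘ Sum.inl) + y (Sum.inr ()) • b) (y ∘ Sum.inr) := by
  rw [affineMatrix, Matrix.fromBlocks_mulVec, Matrix.zero_mulVec, zero_add, Matrix.one_mulVec]
  congr 2
  ext i
  simp [Matrix.mulVec, dotProduct, mul_comm]

theorem integerImage_affineMatrix_subset_of_mk_eq [DecidableEq ι]
    {g g' : Matrix.SpecialLinearGroup ι ℝ} {b b' : ι → ℝ}
    (h : (affineElt g b : AffineLatticeSpace ι) = (affineElt g' b' : AffineLatticeSpace ι)) :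
    integerImage (affineMatrix (g' : Matrix ι ι ℝ) b') ⊆
      integerImage (affineMatrix (g : Matrix ι ι ℝ) b) := by
  obtain ⟨γ, k, hγ⟩ := QuotientGroup.eq.1 h
  rw [inv_mul_eq_iff_eq_mul, affineElt_mul] at hγ
  have hg : g' = g * Matrix.SpecialLinearGroup.map (Int.castRingHom ℝ) γ :=
    congrArg SemidirectProduct.right hγ
  have hb : b' = b + (g : Matrix ι ι ℝ) *ᵥ fun i => (k i : ℝ) :=
    congrArg (fun a => Multiplicative.toAdd (SemidirectProduct.left a)) hγ
  have hmul : affineMatrix (g' : Matrix ι ι ℝ) b' = affineMatrix (g : Matrix ι ι ℝ) b *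
      affineMatrix ((γ : Matrix ι ι ℤ).map Int.cast) fun i => k i := by
    rw [affineMatrix_mul, hg, hb]
    rfl
  rw [hmul, ← map_intCast_fromBlocks]
  exact integerImage_mul_map_intCast_subset _ _

theorem integerImage_affineMatrix_eq_of_mk_eq [DecidableEq ι]
    {g g' : Matrix.SpecialLinearGroup ι ℝ} {b b' : ι → ℝ}
    (h : (affineElt g b : AffineLatticeSpace ι) = (affineElt g' b' : AffineLatticeSpace ι)) :
    integerImage (affineMatrix (g : Matrix ι ι ℝ) b) =
      integerImage (affineMatrix (g' : Matrix ι ι ℝ) b') :=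
  (integerImage_affineMatrix_subset_of_mk_eq h.symm).antisymm
    (integerImage_affineMatrix_subset_of_mk_eq h)

theorem one_le_norm_intCast {p : ι → ℤ} (hp : p ≠ 0) : 1 ≤ ‖fun i => (p i : ℝ)‖ := by
  obtain ⟨i, hi⟩ := Function.ne_iff.1 hp
  calc (1 : ℝ) ≤ |(p i : ℝ)| := by exact_mod_cast Int.one_le_abs hi
    _ ≤ ‖fun i => (p i : ℝ)‖ := norm_le_pi_norm (fun i => (p i : ℝ)) i

theorem exists_norm_le_mul_norm_mulVec [DecidableEq ι] {h : Matrix ι ι ℝ} (hh : h.det ≠ 0) :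
    ∃ K > 0, ∀ x, ‖x‖ ≤ K * ‖h *ᵥ x‖ := by
  have hinj : Function.Injective h.mulVecLin :=
    Matrix.mulVec_injective_of_isUnit ((Matrix.isUnit_iff_isUnit_det h).2 hh.isUnit)
  obtain ⟨K, hK, hanti⟩ := h.mulVecLin.exists_antilipschitzWith (LinearMap.ker_eq_bot.2 hinj)
  exact ⟨K, hK, ZeroHomClass.bound_of_antilipschitz _ hanti⟩

theorem exists_le_rpow_mul_norm_of_mem_integerImage [DecidableEq ι] {h : Matrix ι ι ℝ}
    (hh : h.det ≠ 0) {v : ι → ℝ} (hv : ¬ IsLiouvilleVector v) :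
    ∃ c > 0, c ≤ 1 ∧ ∃ E > (0 : ℝ), ∀ y ∈ integerImage (affineMatrix h (h *ᵥ v)), y ≠ 0 →
      ∀ B, 1 ≤ B → |y (Sum.inr ())| ≤ B → c ≤ B ^ E * ‖y ∘ Sum.inl‖ := by
  obtain ⟨c, hc, E, hE, hdioph⟩ := exists_le_rpow_mul_norm_add_of_not_isLiouvilleVector hv
  obtain ⟨K, hK, hinv⟩ := exists_norm_le_mul_norm_mulVec hh
  refine ⟨min 1 (min c 1 / K), by positivity, min_le_left _ _, E, hE, ?_⟩
  rintro _ ⟨k, rfl⟩ hy B hB hqB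
  let p : ι → ℝ := fun i => k (Sum.inl i)
  let q : ℝ := k (Sum.inr ())
  have hyk : affineMatrix h (h *ᵥ v) *ᵥ (fun i => (k i : ℝ)) =
      Sum.elim (h *ᵥ (p + q • v)) fun _ => q := by
    rw [affineMatrix_mulVec, Matrix.mulVec_add, Matrix.mulVec_smul]
    rfl
  simp only [hyk, Sum.elim_comp_inl, Sum.elim_inr] at hy hqB ⊢
  have hle : min c 1 ≤ B ^ E * ‖p + q • v‖ := by
    rcases eq_or_ne (k (Sum.inr ())) 0 with hk | hk
    · have hq : q = 0 := by simp [q, hk]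
      have hp : (fun i => k (Sum.inl i)) ≠ 0 := by
        intro hp
        have hp0 : p = 0 := funext fun i => by simpa [p] using congrFun hp i
        exact hy (by simp [hp0, hq, ← Pi.zero_def])
      rw [hq, zero_smul, add_zero]
      exact (min_le_right _ _).trans
        (one_le_mul_of_one_le_of_one_le (Real.one_le_rpow hB hE.le) (one_le_norm_intCast hp))
    · calc min c 1 ≤ |q| ^ E * ‖p + q • v‖ := (min_le_left _ _).trans (hdioph _ _ hk)
        _ ≤ B ^ E * ‖p + q • v‖ := by gcongr
  calc min 1 (min c 1 / K) ≤ min c 1 / K := min_le_right _ _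
    _ ≤ B ^ E * ‖h *ᵥ (p + q • v)‖ := by
        rw [div_le_iff₀' hK]
        calc min c 1 ≤ B ^ E * ‖p + q • v‖ := hle
          _ ≤ B ^ E * (K * ‖h *ᵥ (p + q • v)‖) := by gcongr; exact hinv _
          _ = K * (B ^ E * ‖h *ᵥ (p + q • v)‖) := by ring

end AffineLattice

section CylinderSet

variable {m n : ℕ} {w : Fin m ⊕ Fin n → ℝ} {g : Matrix.SpecialLinearGroup (Fin m ⊕ Fin n) ℝ}
  {v : Fin m ⊕ Fin n → ℝ} {L : ℝ}

theorem cylinderSet_eq_of_mk_eq {g' : Matrix.SpecialLinearGroup (Fin m ⊕ Fin n) ℝ}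
    {v' : Fin m ⊕ Fin n → ℝ}
    (h : (affineElt g (g.1 *ᵥ v) : AffineLatticeSpace (Fin m ⊕ Fin n)) =
      (affineElt g' (g'.1 *ᵥ v') : AffineLatticeSpace (Fin m ⊕ Fin n))) (t A B : ℝ) :
    cylinderSet w g v t L A B = cylinderSet w g' v' t L A B := by
  simp only [cylinderSet, integerImage_mul, integerImage_affineMatrix_eq_of_mk_eq h]

theorem diagFlow_mul_unipotent_mulVec (w : Fin m ⊕ Fin n → ℝ) (t : ℝ) (θ : Fin m → Fin n → ℝ)
    (x : Fin m ⊕ Fin n → ℝ) :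
    (diagFlow w t * unipotent θ) *ᵥ x = Sum.elim
      (fun i => Real.exp (w (Sum.inl i) * t) * (x (Sum.inl i) + θ i ⬝ᵥ (x ∘ Sum.inr)))
      (fun j => Real.exp (-(w (Sum.inr j)) * t) * x (Sum.inr j)) := by
  rw [← Matrix.mulVec_mulVec, unipotent, Matrix.fromBlocks_mulVec, diagFlow]
  ext (i | j) <;> simp [Matrix.mulVec]

theorem cylinderSet_subset_biUnion_slabMatrices (w : Fin m ⊕ Fin n → ℝ)
    (g : Matrix.SpecialLinearGroup (Fin m ⊕ Fin n) ℝ) (v : Fin m ⊕ Fin n → ℝ) (t L A B : ℝ) :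
    cylinderSet w g v t L A B ⊆
      ⋃ y ∈ {y ∈ integerImage (affineMatrix g.1 (g.1 *ᵥ v)) | y ≠ 0 ∧
          (∀ j, |y (Sum.inl (Sum.inr j))| ≤ A * Real.exp (w (Sum.inr j) * t)) ∧
          |y (Sum.inr ())| ≤ B},
        slabMatrices L (fun i => A * Real.exp (-(w (Sum.inl i) * t))) (y ∘ Sum.inl) := by
  rintro θ ⟨hθ, z, hz, hz0, hzA, hzB⟩
  rw [integerImage_mul] at hz
  obtain ⟨y, hy, rfl⟩ := hz
  simp only [affineMatrix_mulVec, smul_zero, add_zero, Sum.elim_inl, Sum.elim_inr,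
    Function.comp_apply, diagFlow_mul_unipotent_mulVec] at hzA hzB
  have hcoord := fun i => (norm_le_pi_norm _ i).trans hzA
  refine mem_biUnion ⟨hy, ?_, fun j => ?_, hzB⟩ fun i _ => ⟨hθ i, ?_⟩
  · rintro rfl
    simp at hz0
  · have hj := hcoord (Sum.inr j)
    rwa [Sum.elim_inr, Real.norm_eq_abs, abs_mul, Real.abs_exp, neg_mul, Real.exp_neg,
      inv_mul_le_iff₀' (Real.exp_pos _)] at hj
  · have hi := hcoord (Sum.inl i)
    rwa [Sum.elim_inl, Real.norm_eq_abs, abs_mul, Real.abs_exp, ← le_div_iff₀' (Real.exp_pos _),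
      div_eq_mul_inv, ← Real.exp_neg] at hi

theorem prod_mul_exp_neg_mul_prod_exp
    (hsum : ∑ i : Fin m, w (Sum.inl i) = ∑ j : Fin n, w (Sum.inr j)) (A t : ℝ) :
    (∏ i, A * Real.exp (-(w (Sum.inl i) * t))) * ∏ j, Real.exp (w (Sum.inr j) * t) = A ^ m := by
  rw [Finset.prod_mul_distrib, ← Real.exp_sum, ← Real.exp_sum, Finset.sum_neg_distrib,
    ← Finset.sum_mul, ← Finset.sum_mul, hsum, mul_assoc, ← Real.exp_add, neg_add_cancel,
    Real.exp_zero, mul_one, Finset.prod_const, Finset.card_univ, Fintype.card_fin]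

theorem volume_cylinderSet_le_cube (hL : 0 ≤ L) (t A B : ℝ) :
    volume (cylinderSet w g v t L A B) ≤ ENNReal.ofReal (((2 * L) ^ n) ^ m) := by
  simpa using (measure_mono fun θ hθ => hθ.1).trans_eq
    (volume_setOf_forall_mem_Icc (ι := Fin m) (κ := Fin n) hL)

theorem exists_volume_cylinderSet_le_of_le (hw : ∀ i, 0 ≤ w i)
    (hsum : ∑ i : Fin m, w (Sum.inl i) = ∑ j : Fin n, w (Sum.inr j))
    (g : Matrix.SpecialLinearGroup (Fin m ⊕ Fin n) ℝ) (v : Fin m ⊕ Fin n → ℝ) (hL : 0 < L) :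
    ∃ C > 0, ∀ t A B a : ℝ, 0 ≤ t → 0 < A → A ≤ a → a ≤ 1 → 1 ≤ B →
      (∀ y ∈ integerImage (affineMatrix g.1 (g.1 *ᵥ v)), y ≠ 0 → |y (Sum.inr ())| ≤ B →
        2 * a ≤ ‖y ∘ Sum.inl‖) →
      volume (cylinderSet w g v t L A B) ≤ ENNReal.ofReal (C * (B * (A / a) ^ m)) := by
  have hdet : (affineMatrix g.1 (g.1 *ᵥ v)).det ≠ 0 := by
    rw [det_affineMatrix, g.2]
    exact one_ne_zero
  obtain ⟨C, hC, hunion⟩ := exists_volume_biUnion_longLatticeVectors_le hdet hL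
  refine ⟨C, hC, fun t A B a ht hA hAa ha1 hB hlong => ?_⟩
  have ha : 0 < a := hA.trans_le hAa
  let ε : Fin m → ℝ := fun i => A * Real.exp (-(w (Sum.inl i) * t))
  let H : Fin n → ℝ := fun j => Real.exp (w (Sum.inr j) * t)
  have hε : ∀ i, ε i ≤ a := fun i =>
    (mul_le_of_le_one_right hA.le (Real.exp_le_one_iff.2
      (neg_nonpos.2 (mul_nonneg (hw _) ht)))).trans hAa
  have hH : ∀ j, 1 ≤ H j := fun j => Real.one_le_exp (mul_nonneg (hw _) ht)
  have hsub : cylinderSet w g v t L A B ⊆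
      ⋃ y ∈ longLatticeVectors (affineMatrix g.1 (g.1 *ᵥ v)) a H B,
        slabMatrices L ε (y ∘ Sum.inl) := by
    refine (cylinderSet_subset_biUnion_slabMatrices w g v t L A B).trans
      (biUnion_subset_biUnion_left ?_)
    rintro y ⟨hy, hy0, hyH, hyB⟩
    exact ⟨hy, hlong y hy hy0 hyB, fun j => (hyH j).trans
      (mul_le_of_le_one_left (Real.exp_pos _).le (hAa.trans ha1)), hyB⟩
  calc volume (cylinderSet w g v t L A B)
      ≤ ENNReal.ofReal (C * (B * (1 / a) ^ m * ((∏ i, ε i) * ∏ j, H j))) := by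
        simpa using (measure_mono hsub).trans
          (hunion a B ε H ha ha1 hB (fun i => by positivity) hε hH)
    _ = ENNReal.ofReal (C * (B * (A / a) ^ m)) := by
        rw [prod_mul_exp_neg_mul_prod_exp hsum, mul_assoc B, ← mul_pow, one_div_mul_eq_div]

theorem exists_volume_cylinderSet_le_of_le_norm (hw : ∀ i, 0 ≤ w i)
    (hsum : ∑ i : Fin m, w (Sum.inl i) = ∑ j : Fin n, w (Sum.inr j))
    (g : Matrix.SpecialLinearGroup (Fin m ⊕ Fin n) ℝ) (v : Fin m ⊕ Fin n → ℝ) (hL : 0 < L) :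
    ∃ C > 0, ∀ t A B a : ℝ, 0 ≤ t → 0 < A → 0 < a → a ≤ 1 → 1 ≤ B →
      (∀ y ∈ integerImage (affineMatrix g.1 (g.1 *ᵥ v)), y ≠ 0 → |y (Sum.inr ())| ≤ B →
        2 * a ≤ ‖y ∘ Sum.inl‖) →
      volume (cylinderSet w g v t L A B) ≤ ENNReal.ofReal (C * (B * (A / a) ^ m)) := by
  obtain ⟨C, hC, hsmall⟩ := exists_volume_cylinderSet_le_of_le hw hsum g v hL
  refine ⟨max C (((2 * L) ^ n) ^ m), lt_max_of_lt_left hC,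
    fun t A B a ht hA ha ha1 hB hlong => ?_⟩
  rcases le_or_gt A a with hAa | hAa
  · refine (hsmall t A B a ht hA hAa ha1 hB hlong).trans (ENNReal.ofReal_le_ofReal ?_)
    gcongr
    exact le_max_left _ _
  · refine (volume_cylinderSet_le_cube hL.le t A B).trans (ENNReal.ofReal_le_ofReal ?_)
    have hratio : 1 ≤ (A / a) ^ m := one_le_pow₀ ((one_le_div ha).2 hAa.le)
    calc ((2 * L) ^ n) ^ m ≤ max C (((2 * L) ^ n) ^ m) := le_max_right _ _
      _ ≤ max C (((2 * L) ^ n) ^ m) * (B * (A / a) ^ m) :=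
        le_mul_of_one_le_right (by positivity) (one_le_mul_of_one_le_of_one_le hB hratio)

theorem exists_volume_cylinderSet_le (hw : ∀ i, 0 ≤ w i)
    (hsum : ∑ i : Fin m, w (Sum.inl i) = ∑ j : Fin n, w (Sum.inr j))
    (g : Matrix.SpecialLinearGroup (Fin m ⊕ Fin n) ℝ) (hv : ¬ IsLiouvilleVector v)
    (hL : 0 < L) :
    ∃ β₀ > (0 : ℝ), ∃ β₂ > (0 : ℝ), ∀ t A B : ℝ, 0 ≤ t → 0 < A → 1 ≤ B →
      volume (cylinderSet w g v t L A B) ≤ ENNReal.ofReal (β₀ * A ^ m * B ^ β₂) := by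
  have hdet : g.1.det ≠ 0 := by
    rw [g.2]
    exact one_ne_zero
  obtain ⟨c, hc, hc1, E, hE, hdioph⟩ := exists_le_rpow_mul_norm_of_mem_integerImage hdet hv
  obtain ⟨C, hC, hvol⟩ := exists_volume_cylinderSet_le_of_le_norm hw hsum g v hL
  refine ⟨C * (2 / c) ^ m, by positivity, E * m + 1, by positivity, fun t A B ht hA hB => ?_⟩
  have hB0 : 0 < B := one_pos.trans_le hB
  have hBE : 1 ≤ B ^ E := Real.one_le_rpow hB hE.le
  have ha1 : c / (2 * B ^ E) ≤ 1 := (div_le_one (by positivity)).2 (by linarith)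
  have hlong : ∀ y ∈ integerImage (affineMatrix g.1 (g.1 *ᵥ v)), y ≠ 0 →
      |y (Sum.inr ())| ≤ B → 2 * (c / (2 * B ^ E)) ≤ ‖y ∘ Sum.inl‖ := by
    intro y hy hy0 hyB
    rw [← mul_div_assoc, mul_div_mul_left _ _ two_ne_zero, div_le_iff₀' (by positivity)]
    exact hdioph y hy hy0 B hB hyB
  refine (hvol t A B _ ht hA (by positivity) ha1 hB hlong).trans_eq ?_
  have hpow : B ^ (E * m + 1) = B * (B ^ E) ^ m := by
    rw [Real.rpow_add hB0, Real.rpow_mul_natCast hB0.le, Real.rpow_one, mul_comm]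
  have hratio : A / (c / (2 * B ^ E)) = 2 / c * A * B ^ E := by field_simp
  rw [hpow, hratio, mul_pow, mul_pow]
  congr 1
  ring

end CylinderSet

theorem proposition3p1_general (m n : ℕ) (w : Fin m ⊕ Fin n → ℝ) (hw : ∀ i, 0 ≤ w i)
    (hsum : ∑ i : Fin m, w (Sum.inl i) = ∑ j : Fin n, w (Sum.inr j))
    (y : AffineLatticeSpace (Fin m ⊕ Fin n)) (L : ℝ) (hL : 0 < L) :
    ∃ β₀ > (0 : ℝ), ∃ β₂ > (0 : ℝ),
      ∀ (g : Matrix.SpecialLinearGroup (Fin m ⊕ Fin n) ℝ) (v : Fin m ⊕ Fin n → ℝ),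
        y = affineElt g (g.1 *ᵥ v) → ¬ IsLiouvilleVector v →
        ∀ t A B : ℝ, 0 ≤ t → 0 < A → 1 ≤ B →
          volume (cylinderSet w g v t L A B) ≤ ENNReal.ofReal (β₀ * A ^ m * B ^ β₂) := by
  by_cases hy : ∃ (g : Matrix.SpecialLinearGroup (Fin m ⊕ Fin n) ℝ) (v : Fin m ⊕ Fin n → ℝ),
      y = affineElt g (g.1 *ᵥ v) ∧ ¬ IsLiouvilleVector v
  · obtain ⟨g, v, rfl, hv⟩ := hy
    obtain ⟨β₀, h₀, β₂, h₂, hvol⟩ := exists_volume_cylinderSet_le hw hsum g hv hL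
    refine ⟨β₀, h₀, β₂, h₂, fun g' v' h _ t A B ht hA hB => ?_⟩
    rw [← cylinderSet_eq_of_mk_eq h]
    exact hvol t A B ht hA hB
  · exact ⟨1, one_pos, 1, one_pos, fun g v h hv => absurd ⟨g, v, h, hv⟩ hy⟩

theorem proposition3p1 (m n : ℕ) (hm : 1 ≤ m) (hn : 1 ≤ n)
    (w : Fin m ⊕ Fin n → ℝ) (hw : ∀ i, 0 < w i)
    (hsum : ∑ i : Fin m, w (Sum.inl i) = ∑ j : Fin n, w (Sum.inr j))
    (y : AffineLatticeSpace (Fin m ⊕ Fin n)) (L : ℝ) (hL : 0 < L) :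
    ∃ β₀ β₁ β₂ : ℝ, 0 < β₀ ∧ 0 < β₁ ∧ 0 < β₂ ∧
      ∀ (g : Matrix.SpecialLinearGroup (Fin m ⊕ Fin n) ℝ) (v : Fin m ⊕ Fin n → ℝ),
        y = QuotientGroup.mk
            (affineElt g ((g : Matrix (Fin m ⊕ Fin n) (Fin m ⊕ Fin n) ℝ) *ᵥ v)) →
        ¬ IsLiouvilleVector v →
        ∀ t A B : ℝ, 0 ≤ t → 0 < A → A < 1 → 1 < B →
          MeasureTheory.volume (cylinderSet w g v t L A B) ≤
            ENNReal.ofReal (β₀ * A ^ β₁ * B ^ β₂) := by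
  obtain ⟨β₀, h₀, β₂, h₂, h⟩ := proposition3p1_general m n w (fun i => (hw i).le) hsum y L hL
  exact ⟨β₀, m, β₂, h₀, by exact_mod_cast hm, h₂, fun g v hy hv t A B ht hA _ hB => by
    simpa only [Real.rpow_natCast] using h g v hy hv t A B ht hA hB.le⟩
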